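/- For a continuous $2\pi$-periodic function $f:\mathbb{R}\to\mathbb{R}$ let $\|f\|=\sup_x|f(x)|$, let $E_{n-1}(f)=\inf_{\tau}\|f-\tau\|$, where $\tau$ runs over the real trigonometric polynomials of degree $\le n-1$, and let $$\omega_r(f,\delta)=\sup_{0<h\le\delta}\|\Delta_h^r(f,\cdot)\|,\qquad \Delta_h^r(f,x)=\sum_{i=0}^r(-1)^i\binom{r}{i}f(x+ih),\qquad \gamma_r^*=\frac{1}{\binom{r}{\lfloor r/2\rfloor}}.$$ Theorem. There exist constants $c_r$ $(r=1,2,3,\dots)$, depending only on $r$, such that $$E_{n-1}(f)\le c_r\,\gamma_r^*\,\omega_r\Big(f,\frac{\pi}{n}\Big)$$ for all integers $r\ge1$, $n\ge1$ and all continuous $2\pi$-periodic $f$, with $c_r=O(\sqrt r\,\ln r)$ as $r\to\infty$ and, explicitly, $c_r<2\sqrt r\,\ln r+12\sqrt r$ for every $r\ge1$. -/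

import Mathlib

/-! Uniform approximation of continuous `2π`-periodic real functions (viewed as functions on `ℝ`)
by trigonometric polynomials. -/

noncomputable section

namespace JacksonStechkin

/-- The uniform norm `‖f‖ = sup_x |f x|` (applied to bounded functions only). -/
def supNorm (f : ℝ → ℝ) : ℝ := ⨆ x : ℝ, |f x|

/-- `T_N`: real trigonometric polynomials of degree at most `N`. -/
def trigPolys (N : ℕ) : Set (ℝ → ℝ) :=
  {τ | ∃ a b : ℕ → ℝ, ∀ x : ℝ,
    τ x = ∑ k ∈ Finset.range (N + 1), (a k * Real.cos (k * x) + b k * Real.sin (k * x))}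

/-- `E_N(f)`: the value of best uniform approximation of `f` by elements of `T_N`. -/
def bestApprox (N : ℕ) (f : ℝ → ℝ) : ℝ :=
  ⨅ τ : trigPolys N, supNorm (fun x => f x - (τ : ℝ → ℝ) x)

/-- `Δ_h^r(f, x) = ∑_{i=0}^r (-1)^i (r choose i) f (x + i h)`. -/
def difference (r : ℕ) (h : ℝ) (f : ℝ → ℝ) (x : ℝ) : ℝ :=
  ∑ i ∈ Finset.range (r + 1), (-1 : ℝ) ^ i * (r.choose i : ℝ) * f (x + i * h)

/-- The `r`-th modulus of smoothness `ω_r(f, δ) = sup_{0 < h ≤ δ} ‖Δ_h^r(f, ·)‖`. -/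
def modulus (r : ℕ) (f : ℝ → ℝ) (δ : ℝ) : ℝ :=
  ⨆ h : Set.Ioc (0 : ℝ) δ, supNorm (difference r (h : ℝ) f)

/-- `γ_r^* = 1 / (r choose ⌊r/2⌋)`; the division `r / 2` is the integer one. -/
def gammaStar (r : ℕ) : ℝ := 1 / (r.choose (r / 2) : ℝ)

end JacksonStechkin

end

/-! ### Exponential sums and Fourier multipliers -/

namespace JacksonStechkin

/-! Everything is a norm estimate for Fourier multipliers acting on exponential sums; density then
carries the result to continuous `f`. For even order `2k`, divide the central difference of step `t
* h` by its middle binomial coefficient and average over `t` with weight `2 * (1 - t)`. The result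
is `1 - U`, where `U` has symbol `u = smoothingSymbol k h`, and `(1 - U) f` is at most the modulus
times `gammaStar (2 * k)`. It remains to invert `1 - U` modulo degrees below `n`. With `h = π / n`,
the symbol `l² u(l)` is a finite cosine sum of norm at most `ρ n²`, where `1 - ρ = 4 / (π² (√k +
1))` (`hasMultiplierBound_sq_mul_smoothingSymbol`). A Favard-type kernel realises `l ^ (-2j)` on
`|l| ≥ n` with norm at most `2 n ^ (-2j)` (`exists_multiplier_eq_inv_pow`). Hence `u ^ j` agrees
there with a multiplier of norm at most `2 ρ ^ j`, and the Neumann series gives an inverse of norm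
`2 / (1 - ρ)`, of order `√k` (`exists_approx_of_multiplier`). Odd orders reduce to the next even
order without loss. The outcome is `c r = 10 √r`, with no logarithm. -/

/-- The complex trigonometric polynomial `∑_{l ∈ s} c_l e^{ilx}`. -/
noncomputable def trigSum (s : Finset ℤ) (c : ℤ → ℂ) (x : ℝ) : ℂ :=
  ∑ l ∈ s, c l * Complex.exp (Complex.I * l * x)

/-- The Fourier multiplier `m` has norm at most `B` with respect to the uniform norm. -/
def HasMultiplierBound (m : ℤ → ℂ) (B : ℝ) : Prop :=
  ∀ (s : Finset ℤ) (c : ℤ → ℂ) (C : ℝ), (∀ x, ‖trigSum s c x‖ ≤ C) →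
    ∀ x, ‖trigSum s (fun l => m l * c l) x‖ ≤ B * C

theorem trigSum_add (s : Finset ℤ) (c d : ℤ → ℂ) (x : ℝ) :
    trigSum s (fun l => c l + d l) x = trigSum s c x + trigSum s d x := by
  simp [trigSum, add_mul, Finset.sum_add_distrib]

theorem trigSum_const_mul (s : Finset ℤ) (a : ℂ) (c : ℤ → ℂ) (x : ℝ) :
    trigSum s (fun l => a * c l) x = a * trigSum s c x := by
  simp [trigSum, Finset.mul_sum, mul_assoc]

theorem trigSum_sum {ι : Type*} (t : Finset ι) (s : Finset ℤ) (c : ι → ℤ → ℂ) (x : ℝ) :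
    trigSum s (fun l => ∑ i ∈ t, c i l) x = ∑ i ∈ t, trigSum s (c i) x := by
  simp only [trigSum, Finset.sum_mul]
  exact Finset.sum_comm

theorem trigSum_exp_mul (s : Finset ℤ) (c : ℤ → ℂ) (a x : ℝ) :
    trigSum s (fun l => Complex.exp (Complex.I * l * a) * c l) x = trigSum s c (x + a) := by
  refine Finset.sum_congr rfl fun l _ => ?_
  beta_reduce
  rw [mul_comm (Complex.exp _) (c l), mul_assoc, ← Complex.exp_add]
  push_cast
  ring_nf

theorem exists_norm_trigSum_le (s : Finset ℤ) (c : ℤ → ℂ) :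
    ∃ C, ∀ x, ‖trigSum s c x‖ ≤ C := by
  refine ⟨∑ l ∈ s, ‖c l‖, fun x => (norm_sum_le _ _).trans (Finset.sum_le_sum fun l _ => ?_)⟩
  have : Complex.I * l * x = ((l * x : ℝ) : ℂ) * Complex.I := by push_cast; ring
  rw [norm_mul, this, Complex.norm_exp_ofReal_mul_I, mul_one]

namespace HasMultiplierBound

variable {m m₁ m₂ : ℤ → ℂ} {B B₁ B₂ : ℝ}

theorem mono (h : HasMultiplierBound m B₁) (hB : B₁ ≤ B₂) : HasMultiplierBound m B₂ :=
  fun s c C hC x => (h s c C hC x).trans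
    (mul_le_mul_of_nonneg_right hB ((norm_nonneg _).trans (hC 0)))

theorem one : HasMultiplierBound (fun _ => 1) 1 := by
  intro s c C hC x
  simpa using hC x

theorem zero : HasMultiplierBound (fun _ => 0) 0 := by
  intro s c C hC x
  simp [trigSum]

theorem exp (a : ℝ) : HasMultiplierBound (fun l => Complex.exp (Complex.I * l * a)) 1 := by
  intro s c C hC x
  rw [trigSum_exp_mul, one_mul]
  exact hC _

theorem add (h₁ : HasMultiplierBound m₁ B₁) (h₂ : HasMultiplierBound m₂ B₂) :
    HasMultiplierBound (fun l => m₁ l + m₂ l) (B₁ + B₂) := by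
  intro s c C hC x
  simp only [add_mul, trigSum_add]
  exact (norm_add_le _ _).trans (add_le_add (h₁ s c C hC x) (h₂ s c C hC x))

theorem const_mul (h : HasMultiplierBound m B) (a : ℂ) :
    HasMultiplierBound (fun l => a * m l) (‖a‖ * B) := by
  intro s c C hC x
  simp only [mul_assoc, trigSum_const_mul, norm_mul]
  exact mul_le_mul_of_nonneg_left (h s c C hC x) (norm_nonneg _)

theorem mul (h₁ : HasMultiplierBound m₁ B₁) (h₂ : HasMultiplierBound m₂ B₂) :
    HasMultiplierBound (fun l => m₁ l * m₂ l) (B₁ * B₂) := by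
  intro s c C hC x
  simp only [mul_assoc]
  exact h₁ s _ _ (h₂ s c C hC) x

theorem pow (h : HasMultiplierBound m B) (j : ℕ) :
    HasMultiplierBound (fun l => m l ^ j) (B ^ j) := by
  induction j with
  | zero => simpa using one
  | succ j ih => simpa only [pow_succ] using ih.mul h

theorem sum {ι : Type*} (t : Finset ι) {m : ι → ℤ → ℂ} {B : ι → ℝ}
    (h : ∀ i ∈ t, HasMultiplierBound (m i) (B i)) :
    HasMultiplierBound (fun l => ∑ i ∈ t, m i l) (∑ i ∈ t, B i) := by
  classical
  induction t using Finset.induction_on with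
  | empty => simpa using zero
  | insert a t ha ih =>
    simp only [Finset.sum_insert ha]
    exact (h a (by simp)).add (ih fun i hi => h i (by simp [hi]))

theorem cos (a : ℝ) : HasMultiplierBound (fun l => ((Real.cos (l * a) : ℝ) : ℂ)) 1 := by
  have h := ((exp a).add (exp (-a))).const_mul (1 / 2)
  convert h using 1
  · ext l
    rw [Complex.ofReal_cos, Complex.cos]
    push_cast
    ring_nf
  · norm_num

/-- Multiplication by the unimodular function `e^{iax}` preserves the uniform norm and translates
frequencies. -/
theorem shift (h : HasMultiplierBound m B) (a : ℤ) :
    HasMultiplierBound (fun l => m (l + a)) B := by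
  intro s c C hC x
  have key : ∀ (d : ℤ → ℂ) (y : ℝ), trigSum (s.map (addRightEmbedding a)) (fun l => d (l - a)) y =
      Complex.exp (Complex.I * a * y) * trigSum s d y := by
    intro d y
    simp only [trigSum, Finset.sum_map, Finset.mul_sum, addRightEmbedding_apply,
      add_sub_cancel_right]
    refine Finset.sum_congr rfl fun l _ => ?_
    rw [mul_left_comm, ← Complex.exp_add]
    push_cast
    ring_nf
  have hn : ∀ y : ℝ, ‖Complex.exp (Complex.I * a * y)‖ = 1 := by
    intro y
    have : Complex.I * a * y = ((a * y : ℝ) : ℂ) * Complex.I := by push_cast; ring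
    rw [this, Complex.norm_exp_ofReal_mul_I]
  have h1 := h (s.map (addRightEmbedding a)) (fun l => c (l - a)) C
    (fun y => by rw [key, norm_mul, hn, one_mul]; exact hC y) x
  have h2 := key (fun l => m (l + a) * c l) x
  simp only [sub_add_cancel] at h2
  rwa [h2, norm_mul, hn, one_mul] at h1

end HasMultiplierBound

theorem integral_exp_int (k : ℤ) :
    ∫ t in (0 : ℝ)..(2 * Real.pi), Complex.exp (Complex.I * k * t) =
      if k = 0 then (2 * Real.pi : ℂ) else 0 := by
  split_ifs with hk
  · subst hk
    simp
  · have hne : Complex.I * k ≠ 0 := mul_ne_zero Complex.I_ne_zero (by exact_mod_cast hk)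
    rw [integral_exp_mul_complex hne]
    have : Complex.I * k * ((2 * Real.pi : ℝ) : ℂ) = k * (2 * Real.pi * Complex.I) := by
      push_cast; ring
    rw [this, Complex.exp_int_mul_two_pi_mul_I]
    simp

theorem card_pairs_sub_eq (N : ℕ) (l : ℤ) :
    ∑ i ∈ Finset.Ico (0 : ℤ) N, ∑ j ∈ Finset.Ico (0 : ℤ) N, (if i - j - l = 0 then (1 : ℂ) else 0) =
      ((N - l.natAbs : ℕ) : ℂ) := by
  have : ∀ i ∈ Finset.Ico (0 : ℤ) N, ∑ j ∈ Finset.Ico (0 : ℤ) N,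
      (if i - j - l = 0 then (1 : ℂ) else 0) = if i ∈ Finset.Ico l (N + l) then 1 else 0 := by
    intro i _
    have : ∀ j : ℤ, (i - j - l = 0) = (i - l = j) := fun j => propext (by omega)
    simp only [this, Finset.sum_ite_eq, Finset.mem_Ico]
    congr 1
    exact propext (by omega)
  rw [Finset.sum_congr rfl this, Finset.sum_ite_mem, Finset.Ico_inter_Ico, Finset.sum_const,
    Int.card_Ico]
  simp only [nsmul_eq_mul, mul_one]
  congr 1
  rcases le_total 0 l with h | h
  · rw [max_eq_right h, min_eq_left (by omega)]; omega
  · rw [max_eq_left h, min_eq_right (by omega)]; omega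

/-- These numbers are the Fourier coefficients of `|D|²`, with `D` a sum of `N` consecutive
exponentials. Convolution with this nonnegative kernel has norm equal to its mean, which is `N`. -/
theorem HasMultiplierBound.fejer (N : ℕ) :
    HasMultiplierBound (fun l => ((N - l.natAbs : ℕ) : ℂ)) N := by
  intro s c C hC x
  set D : ℝ → ℂ := fun t => ∑ i ∈ Finset.Ico (0 : ℤ) N, Complex.exp (Complex.I * i * t) with hD
  have hDc : Continuous D := by simp only [hD]; fun_prop
  have hconj : ∀ t, ((‖D t‖ ^ 2 : ℝ) : ℂ) = ∑ i ∈ Finset.Ico (0 : ℤ) N,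
      ∑ j ∈ Finset.Ico (0 : ℤ) N, Complex.exp (Complex.I * (i - j : ℤ) * t) := by
    intro t
    have : ((‖D t‖ ^ 2 : ℝ) : ℂ) = D t * (starRingEnd ℂ) (D t) := by
      rw [Complex.mul_conj, Complex.normSq_eq_norm_sq]
    rw [this]
    simp only [hD, map_sum, Finset.sum_mul_sum]
    refine Finset.sum_congr rfl fun i _ => Finset.sum_congr rfl fun j _ => ?_
    rw [← Complex.exp_conj, ← Complex.exp_add]
    simp only [map_mul, Complex.conj_I, Complex.conj_ofReal, map_intCast]
    push_cast
    ring_nf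
  have hint : ∀ l : ℤ, ∫ t in (0 : ℝ)..(2 * Real.pi), ((‖D t‖ ^ 2 : ℝ) : ℂ) *
      Complex.exp (Complex.I * l * (-t : ℝ)) = 2 * Real.pi * ((N - l.natAbs : ℕ) : ℂ) := by
    intro l
    have : ∀ t : ℝ, ((‖D t‖ ^ 2 : ℝ) : ℂ) * Complex.exp (Complex.I * l * (-t : ℝ)) =
        ∑ i ∈ Finset.Ico (0 : ℤ) N, ∑ j ∈ Finset.Ico (0 : ℤ) N,
          Complex.exp (Complex.I * (i - j - l : ℤ) * t) := by
      intro t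
      rw [hconj, Finset.sum_mul]
      refine Finset.sum_congr rfl fun i _ => ?_
      rw [Finset.sum_mul]
      refine Finset.sum_congr rfl fun j _ => ?_
      rw [← Complex.exp_add]
      push_cast
      ring_nf
    simp only [this]
    rw [intervalIntegral.integral_finsetSum
      (fun i _ => Continuous.intervalIntegrable (by fun_prop) _ _)]
    have h2 : ∀ i ∈ Finset.Ico (0 : ℤ) N, ∫ t in (0 : ℝ)..(2 * Real.pi),
        ∑ j ∈ Finset.Ico (0 : ℤ) N, Complex.exp (Complex.I * (i - j - l : ℤ) * t) =
        ∑ j ∈ Finset.Ico (0 : ℤ) N,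
          (2 * Real.pi : ℂ) * (if i - j - l = 0 then (1 : ℂ) else 0) := by
      intro i _
      rw [intervalIntegral.integral_finsetSum
        (fun j _ => Continuous.intervalIntegrable (by fun_prop) _ _)]
      refine Finset.sum_congr rfl fun j _ => ?_
      rw [integral_exp_int]
      simp
    rw [Finset.sum_congr rfl h2]
    simp only [← Finset.mul_sum]
    rw [card_pairs_sub_eq]
  have hpi : (0 : ℝ) < 2 * Real.pi := by positivity
  have hnorm : ∫ t in (0 : ℝ)..(2 * Real.pi), ‖D t‖ ^ 2 = 2 * Real.pi * N := by
    have := hint 0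
    simp only [Int.cast_zero, mul_zero, zero_mul, Complex.exp_zero, mul_one, Int.natAbs_zero,
      Nat.sub_zero] at this
    rw [intervalIntegral.integral_ofReal] at this
    exact_mod_cast this
  have hmain : ∫ t in (0 : ℝ)..(2 * Real.pi), ((‖D t‖ ^ 2 : ℝ) : ℂ) * trigSum s c (x + (-t : ℝ)) =
      2 * Real.pi * trigSum s (fun l => ((N - l.natAbs : ℕ) : ℂ) * c l) x := by
    have : ∀ t : ℝ, ((‖D t‖ ^ 2 : ℝ) : ℂ) * trigSum s c (x + (-t : ℝ)) = ∑ l ∈ s,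
        (c l * Complex.exp (Complex.I * l * x)) *
          (((‖D t‖ ^ 2 : ℝ) : ℂ) * Complex.exp (Complex.I * l * (-t : ℝ))) := by
      intro t
      rw [← trigSum_exp_mul, trigSum, Finset.mul_sum]
      exact Finset.sum_congr rfl fun l _ => by ring
    simp only [this]
    rw [intervalIntegral.integral_finsetSum
      (fun l _ => Continuous.intervalIntegrable (by fun_prop) _ _), trigSum, Finset.mul_sum]
    refine Finset.sum_congr rfl fun l _ => ?_
    rw [intervalIntegral.integral_const_mul, hint]
    ring
  have hle : ‖∫ t in (0 : ℝ)..(2 * Real.pi),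
      ((‖D t‖ ^ 2 : ℝ) : ℂ) * trigSum s c (x + (-t : ℝ))‖ ≤
      ∫ t in (0 : ℝ)..(2 * Real.pi), ‖D t‖ ^ 2 * C := by
    refine intervalIntegral.norm_integral_le_of_norm_le hpi.le (Filter.Eventually.of_forall ?_)
      (Continuous.intervalIntegrable (by fun_prop) _ _)
    intro t _
    rw [norm_mul, Complex.norm_real, Real.norm_of_nonneg (by positivity)]
    exact mul_le_mul_of_nonneg_left (hC _) (by positivity)
  rw [hmain, intervalIntegral.integral_mul_const, hnorm, norm_mul] at hle
  have h2pi : ‖(2 * Real.pi : ℂ)‖ = 2 * Real.pi := by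
    simp [abs_of_pos Real.pi_pos]
  rw [h2pi, mul_assoc _ (N : ℝ)] at hle
  exact le_of_mul_le_mul_left hle hpi

/-- Summation by parts twice: `μ` becomes a combination of Fejér coefficients, with second
differences as weights. For convex decreasing `μ ≥ 0` all weights are nonnegative, and the case `i =
0` evaluates the total norm. -/
theorem eq_sum_sub_of_le (μ : ℕ → ℝ) (L i : ℕ) (hi : i ≤ L + 1) :
    μ i = ∑ N ∈ Finset.range L, (μ N - 2 * μ (N + 1) + μ (N + 2)) * ((N + 1 - i : ℕ) : ℝ) +
      (μ L - μ (L + 1)) * ((L + 1 - i : ℕ) : ℝ) + μ (L + 1) := by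
  induction L with
  | zero => interval_cases i <;> simp
  | succ L ih =>
    rw [Finset.sum_range_succ]
    rcases Nat.lt_or_ge i (L + 2) with h | h
    · have h1 := ih (by omega)
      rw [Nat.cast_sub (by omega)] at h1 ⊢
      rw [Nat.cast_sub (by omega)]
      push_cast at h1 ⊢
      linarith
    · obtain rfl : i = L + 2 := by omega
      have : ∑ N ∈ Finset.range L, (μ N - 2 * μ (N + 1) + μ (N + 2)) *
          ((N + 1 - (L + 2) : ℕ) : ℝ) = 0 := by
        refine Finset.sum_eq_zero fun N hN => ?_
        rw [Finset.mem_range] at hN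
        rw [Nat.sub_eq_zero_of_le (by omega)]
        simp
      rw [this]
      simp

/-- A nonnegative, decreasing, convex sequence `μ` is a multiplier of norm at most `μ 0`. -/
theorem HasMultiplierBound.of_convex {μ : ℕ → ℝ} (h0 : ∀ i, 0 ≤ μ i)
    (h1 : ∀ i, 0 ≤ μ i - μ (i + 1)) (h2 : ∀ i, 0 ≤ μ i - 2 * μ (i + 1) + μ (i + 2)) :
    HasMultiplierBound (fun l => (μ l.natAbs : ℂ)) (μ 0) := by
  intro s c C hC x
  -- Only frequencies in `s` matter, so a finite expansion suffices.
  set L := s.sup Int.natAbs with hL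
  have hb := ((HasMultiplierBound.sum (Finset.range L) fun N _ =>
      (HasMultiplierBound.fejer (N + 1)).const_mul
        ((μ N - 2 * μ (N + 1) + μ (N + 2) : ℝ) : ℂ)).add
      ((HasMultiplierBound.fejer (L + 1)).const_mul ((μ L - μ (L + 1) : ℝ) : ℂ))).add
      (HasMultiplierBound.one.const_mul (μ (L + 1) : ℂ)) s c C hC x
  simp only [Complex.norm_real, Real.norm_of_nonneg (h0 _), Real.norm_of_nonneg (h1 _),
    Real.norm_of_nonneg (h2 _), mul_one] at hb
  have e0 := eq_sum_sub_of_le μ L 0 (by omega)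
  simp only [Nat.sub_zero] at e0
  rw [← e0] at hb
  convert hb using 2
  refine Finset.sum_congr rfl fun l hl => ?_
  have hle : l.natAbs ≤ L := Finset.le_sup (f := Int.natAbs) hl
  beta_reduce
  rw [eq_sum_sub_of_le μ L l.natAbs (by omega)]
  push_cast
  rfl

end JacksonStechkin

/-! ### A kernel of Favard type -/

namespace JacksonStechkin

/-- Complete monotonicity of order `j` of a real sequence. -/
def CompletelyMonotone : ℕ → (ℕ → ℝ) → Prop
  | 0, φ => ∀ i, 0 ≤ φ i
  | j + 1, φ => (∀ i, 0 ≤ φ i) ∧ CompletelyMonotone j (fun i => φ i - φ (i + 1))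

namespace CompletelyMonotone

theorem nonneg {j : ℕ} {φ : ℕ → ℝ} (h : CompletelyMonotone j φ) (i : ℕ) : 0 ≤ φ i := by
  cases j with
  | zero => exact h i
  | succ j => exact h.1 i

theorem of_succ {j : ℕ} {φ : ℕ → ℝ} (h : CompletelyMonotone (j + 1) φ) :
    CompletelyMonotone j φ := by
  induction j generalizing φ with
  | zero => exact h.1
  | succ j ih => exact ⟨h.1, ih h.2⟩

theorem shift {j : ℕ} {φ : ℕ → ℝ} (h : CompletelyMonotone j φ) (p : ℕ) :
    CompletelyMonotone j (fun i => φ (i + p)) := by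
  induction j generalizing φ with
  | zero => exact fun i => h _
  | succ j ih =>
    refine ⟨fun i => h.1 _, ?_⟩
    have := ih h.2
    simpa only [add_right_comm] using this

theorem add {j : ℕ} {φ ψ : ℕ → ℝ} (h : CompletelyMonotone j φ) (h' : CompletelyMonotone j ψ) :
    CompletelyMonotone j (fun i => φ i + ψ i) := by
  induction j generalizing φ ψ with
  | zero => exact fun i => add_nonneg (h i) (h' i)
  | succ j ih =>
    refine ⟨fun i => add_nonneg (h.1 i) (h'.1 i), ?_⟩
    have := ih h.2 h'.2
    convert this using 2
    ring

/-- Leibniz rule: the difference of `φ ψ` is `(φ i - φ (i+1)) ψ i + φ (i+1) (ψ i - ψ (i+1))`. -/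
theorem mul {j : ℕ} {φ ψ : ℕ → ℝ} (h : CompletelyMonotone j φ) (h' : CompletelyMonotone j ψ) :
    CompletelyMonotone j (fun i => φ i * ψ i) := by
  induction j generalizing φ ψ with
  | zero => exact fun i => mul_nonneg (h i) (h' i)
  | succ j ih =>
    refine ⟨fun i => mul_nonneg (h.1 i) (h'.1 i), ?_⟩
    have := (ih h.2 h'.of_succ).add (ih (h.of_succ.shift 1) h'.2)
    convert this using 2
    ring

theorem one (j : ℕ) : CompletelyMonotone j (fun _ => 1) := by
  have zero : ∀ j, CompletelyMonotone j (fun _ => 0) := by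
    intro j
    induction j with
    | zero => exact fun i => le_rfl
    | succ j ih => exact ⟨fun i => le_rfl, by simpa using ih⟩
  cases j with
  | zero => exact fun i => zero_le_one
  | succ j => exact ⟨fun i => zero_le_one, by simpa using zero j⟩

theorem pow {j : ℕ} {φ : ℕ → ℝ} (h : CompletelyMonotone j φ) (q : ℕ) :
    CompletelyMonotone j (fun i => φ i ^ q) := by
  induction q with
  | zero => simpa using one j
  | succ q ih => simpa only [pow_succ] using ih.mul h

/-- The difference of `1 / (n + i)` is its product with its own shift, so the order climbs by `mul`.
-/
theorem inv_add (j : ℕ) {n : ℕ} (hn : 1 ≤ n) :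
    CompletelyMonotone j (fun i => ((n + i : ℝ))⁻¹) := by
  induction j with
  | zero => exact fun i => by positivity
  | succ j ih =>
    refine ⟨fun i => by positivity, ?_⟩
    have := ih.mul (ih.shift 1)
    convert this using 2 with i
    have h1 : (n + i : ℝ) ≠ 0 := by positivity
    have h2 : (n + (i + 1) : ℝ) ≠ 0 := by positivity
    push_cast
    field_simp
    ring

/-- Taking a difference of step `p` lowers the order of complete monotonicity by one. -/
theorem sub_shift {j : ℕ} {φ : ℕ → ℝ} (h : CompletelyMonotone (j + 1) φ) (p : ℕ) :
    CompletelyMonotone j (fun i => φ i - φ (i + p)) := by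
  induction p with
  | zero =>
    simpa using ((show CompletelyMonotone j fun _ => (0 : ℝ) by
      have := (one (j + 1)).2
      simpa using this))
  | succ p ih =>
    have := ih.add (h.2.shift p)
    convert this using 2
    ring_nf

end CompletelyMonotone

open CompletelyMonotone in
/-- If `φ` is completely monotone of order three and tends to zero, there is a multiplier with
norm at most `2 φ(0)` whose value at `l` is `φ(|l| - n)` whenever `|l| ≥ n`. -/
theorem exists_multiplier_eq {φ : ℕ → ℝ} (h : CompletelyMonotone 3 φ)
    (h0 : Filter.Tendsto φ Filter.atTop (nhds 0)) {n : ℕ} (hn : 1 ≤ n) :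
    ∃ m : ℤ → ℂ, HasMultiplierBound m (2 * φ 0) ∧
      ∀ l : ℤ, n ≤ l.natAbs → m l = φ (l.natAbs - n) := by
  have hanti : Antitone φ := antitone_nat_of_succ_le fun i => by
    have := h.2.nonneg i
    linarith
  -- The aim is a convex `μ` with `μ i + μ (i + 2n) = φ i`. The solution is the alternating series
  -- `φ i - φ (i + 2n) + φ (i + 4n) - ...`; grouping its terms in pairs gives sums of `ψ` that a
  -- telescoping series dominates.
  set ψ : ℕ → ℝ := fun i => φ i - φ (i + 2 * n) with hψ
  have hcm : CompletelyMonotone 2 ψ := h.sub_shift (2 * n)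
  have htel : ∀ i, HasSum (fun s : ℕ => φ (i + 4 * n * s) - φ (i + 4 * n * (s + 1))) (φ i) := by
    intro i
    rw [hasSum_iff_tendsto_nat_of_nonneg]
    · have : ∀ S, ∑ s ∈ Finset.range S, (φ (i + 4 * n * s) - φ (i + 4 * n * (s + 1))) =
          φ i - φ (i + 4 * n * S) := by
        intro S
        rw [Finset.sum_range_sub' (fun s => φ (i + 4 * n * s))]
        simp
      simp only [this]
      have ht : Filter.Tendsto (fun S => φ (i + 4 * n * S)) Filter.atTop (nhds 0) := by
        refine h0.comp (Filter.tendsto_atTop_mono (fun S => ?_) Filter.tendsto_id)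
        simp only [id]
        nlinarith
      simpa using ht.const_sub (φ i)
    · intro s
      exact sub_nonneg.2 (hanti (by nlinarith))
  have hle : ∀ i s, ψ (i + 4 * n * s) ≤ φ (i + 4 * n * s) - φ (i + 4 * n * (s + 1)) :=
    fun i s => sub_le_sub_left (hanti (by nlinarith)) _
  have hsum : ∀ i, Summable (fun s : ℕ => ψ (i + 4 * n * s)) := fun i =>
    Summable.of_nonneg_of_le (fun s => hcm.nonneg _) (hle i) (htel i).summable
  set μ : ℕ → ℝ := fun i => ∑' s : ℕ, ψ (i + 4 * n * s) with hμ
  have hμ0 : ∀ i, 0 ≤ μ i := fun i => tsum_nonneg fun s => hcm.nonneg _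
  have hμ1 : ∀ i, 0 ≤ μ i - μ (i + 1) := by
    intro i
    simp only [hμ]
    rw [← (hsum i).tsum_sub (hsum (i + 1))]
    refine tsum_nonneg fun s => ?_
    have := hcm.2.nonneg (i + 4 * n * s)
    rwa [add_right_comm] at this
  have hμ2 : ∀ i, 0 ≤ μ i - 2 * μ (i + 1) + μ (i + 2) := by
    intro i
    simp only [hμ]
    rw [← tsum_mul_left, ← (hsum i).tsum_sub ((hsum (i + 1)).mul_left 2),
      ← ((hsum i).sub ((hsum (i + 1)).mul_left 2)).tsum_add (hsum (i + 2))]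
    refine tsum_nonneg fun s => ?_
    have := hcm.2.2 (i + 4 * n * s)
    rw [show i + 1 + 4 * n * s = i + 4 * n * s + 1 by ring,
      show i + 2 + 4 * n * s = i + 4 * n * s + 1 + 1 by ring]
    linarith
  have hμφ : μ 0 ≤ φ 0 := hasSum_le (hle 0) (hsum 0).hasSum (htel 0)
  have hadd : ∀ i, μ i + μ (i + 2 * n) = φ i := by
    intro i
    simp only [hμ]
    rw [← (hsum i).tsum_add (hsum (i + 2 * n)), ← (htel i).tsum_eq]
    refine tsum_congr fun s => ?_
    simp only [hψ]
    rw [show i + 2 * n + 4 * n * s = i + 4 * n * s + 2 * n by ring,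
      show i + 4 * n * s + 2 * n + 2 * n = i + 4 * n * (s + 1) by ring]
    ring
  -- The multiplier is `μ |l - n| + μ |l + n|`. For `|l| ≥ n` the two arguments are `|l| - n` and
  -- `|l| + n` in some order, so the sum is `φ (|l| - n)`.
  have hm := HasMultiplierBound.of_convex hμ0 hμ1 hμ2
  refine ⟨_, ((hm.shift (-n)).add (hm.shift n)).mono (by linarith), fun l hl => ?_⟩
  rw [← hadd]
  push_cast
  rcases le_total 0 l with h | h
  · rw [show (l + -n).natAbs = l.natAbs - n by omega,
      show (l + n).natAbs = l.natAbs - n + 2 * n by omega]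
  · rw [show (l + -n).natAbs = l.natAbs - n + 2 * n by omega,
      show (l + n).natAbs = l.natAbs - n by omega, add_comm]

theorem exists_multiplier_eq_inv_pow {n : ℕ} (hn : 1 ≤ n) (j : ℕ) :
    ∃ m : ℤ → ℂ, HasMultiplierBound m (2 * (((n : ℝ) ^ 2)⁻¹) ^ j) ∧
      ∀ l : ℤ, n ≤ l.natAbs → m l = (((l : ℂ) ^ 2)⁻¹) ^ j := by
  -- For `j = 0` the sequence does not tend to zero, and the identity multiplier serves instead.
  rcases Nat.eq_zero_or_pos j with rfl | hj
  · exact ⟨fun _ => 1, HasMultiplierBound.one.mono (by norm_num), by simp⟩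
  · obtain ⟨m, hm, hml⟩ := exists_multiplier_eq ((CompletelyMonotone.inv_add 3 hn).pow (2 * j))
      (by
        have : Filter.Tendsto (fun i : ℕ => ((n + i : ℝ))⁻¹) Filter.atTop (nhds 0) :=
          (Filter.tendsto_atTop_add_const_left _ _ tendsto_natCast_atTop_atTop).inv_tendsto_atTop
        simpa [hj.ne'] using this.pow (2 * j)) hn
    refine ⟨m, hm.mono (le_of_eq ?_), fun l hl => ?_⟩
    · simp [pow_mul]
    · rw [hml l hl, Nat.cast_sub hl]
      have h1 : ((l.natAbs : ℝ)) ^ 2 = (l : ℝ) ^ 2 := by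
        rw [Nat.cast_natAbs, Int.cast_abs, sq_abs]
      rw [add_sub_cancel, pow_mul, inv_pow, h1]
      push_cast
      rfl

end JacksonStechkin

/-! ### Inverting the smoothing operator modulo polynomials of low degree -/

namespace JacksonStechkin

/-- If the multiplier `l² u(l)` has norm at most `ρ n²` with `ρ < 1`, then modulo trigonometric
polynomials of degree less than `n` the operator `1 - u` has an inverse of norm at most
`2 / (1 - ρ)`. -/
theorem exists_approx_of_multiplier {n : ℕ} (hn : 1 ≤ n) {u e : ℤ → ℂ} {ρ : ℝ} (hρ0 : 0 ≤ ρ)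
    (hρ1 : ρ < 1) (he : HasMultiplierBound e (ρ * n ^ 2)) (heu : ∀ l : ℤ, e l = l ^ 2 * u l)
    (s : Finset ℤ) (c : ℤ → ℂ) {C : ℝ}
    (hC : ∀ x, ‖trigSum s (fun l => (1 - u l) * c l) x‖ ≤ C) {ε : ℝ} (hε : 0 < ε) :
    ∃ d : ℤ → ℂ, (∀ l, n ≤ l.natAbs → d l = 0) ∧
      ∀ x, ‖trigSum s c x - trigSum s d x‖ ≤ 2 * C / (1 - ρ) + ε := by
  obtain ⟨C₀, hC₀⟩ := exists_norm_trigSum_le s c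
  choose m hm hml using exists_multiplier_eq_inv_pow hn
  have hn' : (n : ℝ) ^ 2 ≠ 0 := by positivity
  have hme : ∀ j, HasMultiplierBound (fun l => m j l * e l ^ j) (2 * ρ ^ j) := by
    intro j
    have := (hm j).mul (he.pow j)
    convert this using 1
    rw [mul_assoc, ← mul_pow, mul_comm ρ, inv_mul_cancel_left₀ hn']
  have hmu : ∀ j, ∀ l : ℤ, n ≤ l.natAbs → m j l * e l ^ j = u l ^ j := by
    intro j l hl
    have : ((l : ℂ) ^ 2) ≠ 0 := by
      have : l ≠ 0 := by rintro rfl; simp at hl; omega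
      exact pow_ne_zero 2 (by exact_mod_cast this)
    rw [hml j l hl, ← mul_pow, heu, inv_mul_cancel_left₀ this]
  have hC0 : 0 ≤ C := (norm_nonneg _).trans (hC 0)
  -- The Neumann series is cut at `M`; its remainder is controlled by the crude bound `C₀`, which
  -- depends on `s` and `c`.
  obtain ⟨M, hM⟩ : ∃ M : ℕ, 2 * ρ ^ M * C₀ < ε := by
    have : Filter.Tendsto (fun M => 2 * ρ ^ M * C₀) Filter.atTop (nhds (2 * 0 * C₀)) :=
      ((tendsto_pow_atTop_nhds_zero_of_lt_one hρ0 hρ1).const_mul 2).mul_const C₀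
    rw [mul_zero, zero_mul] at this
    exact (this.eventually (gt_mem_nhds hε)).exists
  -- For `|l| ≥ n` this is `(∑ u ^ j) (1 - u) c + u ^ M c = c`, so `c - R` has only frequencies
  -- below `n`.
  set R : ℤ → ℂ := fun l => (∑ j ∈ Finset.range M, m j l * e l ^ j) * ((1 - u l) * c l) +
    (m M l * e l ^ M) * c l with hR
  refine ⟨fun l => c l + (-1) * R l, fun l hl => ?_, fun x => ?_⟩
  · have : ∑ j ∈ Finset.range M, m j l * e l ^ j = ∑ j ∈ Finset.range M, u l ^ j :=
      Finset.sum_congr rfl fun j _ => hmu j l hl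
    have h2 := mul_neg_geom_sum (u l) M
    simp only [hR, this, hmu M l hl]
    linear_combination (-c l) * h2
  · rw [trigSum_add, trigSum_const_mul]
    have e1 : trigSum s c x - (trigSum s c x + -1 * trigSum s R x) = trigSum s R x := by ring
    rw [e1, hR, trigSum_add]
    have b1 := HasMultiplierBound.sum (Finset.range M) (fun j _ => hme j) s _ C hC x
    have b2 := hme M s c C₀ hC₀ x
    have b3 : (∑ j ∈ Finset.range M, 2 * ρ ^ j) * C ≤ 2 * C / (1 - ρ) := by
      rw [← Finset.mul_sum, mul_right_comm, div_eq_mul_inv]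
      refine mul_le_mul_of_nonneg_left ?_ (by positivity)
      rw [← tsum_geometric_of_lt_one hρ0 hρ1]
      exact (summable_geometric_of_lt_one hρ0 hρ1).sum_le_tsum _ fun _ _ => by positivity
    exact (norm_add_le _ _).trans (add_le_add (b1.trans b3) (b2.trans hM.le))

end JacksonStechkin

/-! ### Estimates for central binomial ratios -/

namespace JacksonStechkin

/-- The ratio `(2k choose k+i) / (2k choose k)`. -/
noncomputable def binomRatio (k i : ℕ) : ℝ :=
  ((2 * k).choose (k + i) : ℝ) / ((2 * k).choose k : ℝ)

theorem binomRatio_nonneg (k i : ℕ) : 0 ≤ binomRatio k i := by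
  unfold binomRatio
  positivity

theorem binomRatio_eq_zero {k i : ℕ} (h : k < i) : binomRatio k i = 0 := by
  rw [binomRatio, Nat.choose_eq_zero_of_lt (by omega)]
  simp

theorem binomRatio_zero (k : ℕ) : binomRatio k 0 = 1 := by
  have : ((2 * k).choose k : ℝ) ≠ 0 := by
    exact_mod_cast (Nat.choose_pos (by omega)).ne'
  simp [binomRatio, this]

theorem binomRatio_succ {k i : ℕ} (h : i ≤ k) :
    binomRatio k (i + 1) * (k + i + 1) = binomRatio k i * (k - i) := by
  have h1 : ((2 * k).choose (k + i + 1) : ℝ) * (k + i + 1) = (2 * k).choose (k + i) * (k - i) := by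
    have := Nat.choose_succ_right_eq (2 * k) (k + i)
    rw [show 2 * k - (k + i) = k - i by omega] at this
    rw [← Nat.cast_sub h]
    exact_mod_cast this
  simp only [binomRatio, ← add_assoc]
  rw [div_mul_eq_mul_div, h1, div_mul_eq_mul_div]

theorem binomRatio_succ_le (k i : ℕ) : binomRatio k (i + 1) ≤ binomRatio k i := by
  rcases Nat.lt_or_ge k i with h | h
  · rw [binomRatio_eq_zero h, binomRatio_eq_zero (by omega)]
  · have h1 := binomRatio_succ h
    have h2 := binomRatio_nonneg k i
    have h3 : (0 : ℝ) < k + i + 1 := by positivity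
    refine le_of_mul_le_mul_right (h1.trans_le ?_) h3
    exact mul_le_mul_of_nonneg_left (by linarith [(Nat.cast_nonneg i : (0 : ℝ) ≤ i)]) h2

/-- Rational majorant `k / (k + i²)`, by induction on `i` from the exact ratio of consecutive terms.
Divided by `i²` it equals `1/i² - 1/(k + i²)`, a computable gain over `1/i²`. -/
theorem binomRatio_mul_le (k i : ℕ) : binomRatio k i * (k + i ^ 2) ≤ k := by
  induction i with
  | zero => simp [binomRatio_zero]
  | succ i ih =>
    rcases Nat.lt_or_ge k i with h | h
    · rw [binomRatio_eq_zero (by omega), zero_mul]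
      positivity
    · refine le_trans ?_ ih
      have h1 := binomRatio_succ h
      have h2 := binomRatio_nonneg k i
      have h3 : (0 : ℝ) < k + i + 1 := by positivity
      have hi : (0 : ℝ) ≤ i := by positivity
      refine le_of_mul_le_mul_right ?_ h3
      push_cast
      calc binomRatio k (i + 1) * (k + (i + 1) ^ 2) * (k + i + 1)
          = binomRatio k i * ((k - i) * (k + (i + 1) ^ 2)) := by
            linear_combination (k + (i + 1) ^ 2 : ℝ) * h1
        _ ≤ binomRatio k i * ((k + i ^ 2) * (k + i + 1)) := by
            refine mul_le_mul_of_nonneg_left ?_ h2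
            have : (0 : ℝ) ≤ i ^ 3 + i ^ 2 + i * (i + 1) ^ 2 := by positivity
            linarith
        _ = _ := by ring

theorem sum_range_two_mul (g : ℕ → ℝ) (k : ℕ) :
    ∑ i ∈ Finset.range (2 * k), g i = ∑ s ∈ Finset.range k, (g (2 * s) + g (2 * s + 1)) := by
  induction k with
  | zero => simp
  | succ k ih =>
    rw [show 2 * (k + 1) = 2 * k + 1 + 1 by ring, Finset.sum_range_succ, Finset.sum_range_succ, ih,
      Finset.sum_range_succ, add_assoc]

theorem hasSum_inv_odd_sq :
    HasSum (fun s : ℕ => 1 / (2 * s + 1 : ℝ) ^ 2) (Real.pi ^ 2 / 8) := by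
  have h := hasSum_zeta_two
  have he : HasSum (fun s : ℕ => 1 / ((2 * s : ℕ) : ℝ) ^ 2) (1 / 4 * (Real.pi ^ 2 / 6)) := by
    have e : (fun s : ℕ => 1 / ((2 * s : ℕ) : ℝ) ^ 2) = fun s : ℕ => 1 / 4 * (1 / (s : ℝ) ^ 2) := by
      ext s
      push_cast
      rw [mul_pow]
      ring
    rw [e]
    exact h.mul_left _
  have ho : Summable (fun s : ℕ => 1 / ((2 * s + 1 : ℕ) : ℝ) ^ 2) :=
    h.summable.comp_injective (i := fun s : ℕ => 2 * s + 1) fun a b hab => by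
      simp only at hab
      omega
  have := (he.even_add_odd (f := fun s : ℕ => 1 / (s : ℝ) ^ 2) ho.hasSum).unique h
  have h2 := ho.hasSum
  rw [show ∑' s : ℕ, 1 / ((2 * s + 1 : ℕ) : ℝ) ^ 2 = Real.pi ^ 2 / 8 by linarith] at h2
  exact_mod_cast h2

/-- With `a = √k` and `t` odd, `(a + t) (a + t + 2) ≥ k + t²`; this series therefore bounds the gain
`∑ 1/(k + t²)` from below. -/
theorem hasSum_telescope {a : ℝ} (ha : 0 ≤ a) :
    HasSum (fun s : ℕ => 1 / ((a + (2 * s + 1)) * (a + (2 * s + 3)))) (1 / (2 * (a + 1))) := by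
  rw [hasSum_iff_tendsto_nat_of_nonneg (fun s => by positivity)]
  have : ∀ S : ℕ, ∑ s ∈ Finset.range S, 1 / ((a + (2 * s + 1)) * (a + (2 * s + 3))) =
      1 / (2 * (a + 1)) - 1 / 2 * (a + 1 + 2 * S)⁻¹ := by
    intro S
    induction S with
    | zero =>
      have : a + 1 ≠ 0 := by positivity
      simp
      field_simp
      ring
    | succ S ih =>
      rw [Finset.sum_range_succ, ih]
      have : a + 1 ≠ 0 := by positivity
      have : a + 1 + 2 * S ≠ 0 := by positivity
      have : a + (2 * S + 1) ≠ 0 := by positivity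
      have : a + (2 * S + 3) ≠ 0 := by positivity
      have : a + 1 + 2 * (S + 1) ≠ 0 := by positivity
      push_cast
      field_simp
      ring
  simp only [this]
  have ht : Filter.Tendsto (fun S : ℕ => (a + 1 + 2 * (S : ℝ))⁻¹) Filter.atTop (nhds 0) :=
    (Filter.tendsto_atTop_add_const_left _ _
      (tendsto_natCast_atTop_atTop.const_mul_atTop two_pos)).inv_tendsto_atTop
  have h := (ht.const_mul (1 / 2)).const_sub (1 / (2 * (a + 1)))
  rwa [mul_zero, sub_zero] at h

theorem sum_binomRatio_odd_le (k : ℕ) (hk : 1 ≤ k) :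
    ∑ s ∈ Finset.range k, binomRatio k (2 * s + 1) / (2 * s + 1) ^ 2 ≤
      Real.pi ^ 2 / 8 - 1 / (2 * (Real.sqrt k + 1)) := by
  have hterm : ∀ s : ℕ, 0 ≤ binomRatio k (2 * s + 1) / (2 * s + 1 : ℝ) ^ 2 ∧
      binomRatio k (2 * s + 1) / (2 * s + 1 : ℝ) ^ 2 ≤ 1 / (2 * s + 1 : ℝ) ^ 2 -
        1 / ((Real.sqrt k + (2 * s + 1)) * (Real.sqrt k + (2 * s + 3))) := by
    intro s
    refine ⟨div_nonneg (binomRatio_nonneg _ _) (by positivity), ?_⟩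
    have h := binomRatio_mul_le k (2 * s + 1)
    have hk0 : (0 : ℝ) < k := by exact_mod_cast hk
    have hq : Real.sqrt k ^ 2 = k := Real.sq_sqrt hk0.le
    set q := Real.sqrt k
    have hq0 : 0 ≤ q := Real.sqrt_nonneg _
    push_cast at h
    set t : ℝ := 2 * s + 1 with ht
    have ht0 : 0 < t := by positivity
    rw [show (2 * s + 3 : ℝ) = t + 2 by rw [ht]; ring]
    have h1 : binomRatio k (2 * s + 1) ≤ k / (k + t ^ 2) := by
      rwa [le_div_iff₀ (by positivity)]
    have h2 : (k : ℝ) / (k + t ^ 2) / t ^ 2 = 1 / t ^ 2 - 1 / (k + t ^ 2) := by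
      field_simp
      ring
    have h3 : 1 / ((q + t) * (q + (t + 2))) ≤ 1 / (k + t ^ 2) := by
      refine one_div_le_one_div_of_le (by positivity) ?_
      rw [← hq]
      nlinarith [mul_nonneg hq0 ht0.le]
    have h4 : binomRatio k (2 * s + 1) / t ^ 2 ≤ k / (k + t ^ 2) / t ^ 2 :=
      div_le_div_of_nonneg_right h1 (by positivity)
    linarith
  exact (Finset.sum_le_sum fun s _ => (hterm s).2).trans
    (sum_le_hasSum _ (fun s _ => (hterm s).1.trans (hterm s).2)
      (hasSum_inv_odd_sq.sub (hasSum_telescope (Real.sqrt_nonneg _))))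

/-- The terms decrease, so the alternating sum is nonnegative and its absolute value may be dropped.
Adding the plain sum cancels the even multiples and doubles the odd ones. -/
theorem abs_sum_add_sum_binomRatio_le (k : ℕ) (hk : 1 ≤ k) :
    |∑ i ∈ Finset.range k, (-1) ^ i * (binomRatio k (i + 1) / (i + 1) ^ 2)| +
      ∑ i ∈ Finset.range k, binomRatio k (i + 1) / (i + 1) ^ 2 ≤
      2 * (Real.pi ^ 2 / 8 - 1 / (2 * (Real.sqrt k + 1))) := by
  set b : ℕ → ℝ := fun i => binomRatio k (i + 1) / (i + 1) ^ 2 with hb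
  -- Summing to `2k` allows pairing; the added terms vanish because `binomRatio k` is zero beyond
  -- `k`.
  have hext : ∀ w : ℕ → ℝ, ∑ i ∈ Finset.range k, w i * b i =
      ∑ s ∈ Finset.range k, (w (2 * s) * b (2 * s) + w (2 * s + 1) * b (2 * s + 1)) := by
    intro w
    rw [← sum_range_two_mul (fun i => w i * b i)]
    refine Finset.sum_subset (Finset.range_mono (by omega)) fun i _ hi => ?_
    rw [Finset.mem_range, not_lt] at hi
    simp [hb, binomRatio_eq_zero (show k < i + 1 by omega)]
  have hanti : ∀ i, b (i + 1) ≤ b i := by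
    intro i
    refine div_le_div₀ (binomRatio_nonneg _ _) (binomRatio_succ_le _ _) (by positivity) ?_
    push_cast
    gcongr
    linarith
  have h1 : ∑ i ∈ Finset.range k, (-1) ^ i * b i =
      ∑ s ∈ Finset.range k, (b (2 * s) - b (2 * s + 1)) := by
    rw [hext]
    refine Finset.sum_congr rfl fun s _ => ?_
    rw [pow_succ, pow_mul]
    norm_num
    ring
  have h2 : ∑ i ∈ Finset.range k, b i =
      ∑ s ∈ Finset.range k, (b (2 * s) + b (2 * s + 1)) := by
    simpa using hext fun _ => 1
  rw [h1, h2, abs_of_nonneg (Finset.sum_nonneg fun s _ => sub_nonneg.2 (hanti _)),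
    ← Finset.sum_add_distrib]
  have h3 := sum_binomRatio_odd_le k hk
  refine le_trans (le_of_eq ?_) (mul_le_mul_of_nonneg_left h3 zero_le_two)
  rw [Finset.mul_sum]
  refine Finset.sum_congr rfl fun s _ => ?_
  simp only [hb]
  push_cast
  ring

end JacksonStechkin

/-! ### The smoothing operator attached to the difference of order `2k` -/

namespace JacksonStechkin

/-- The cosine transform of the hat function. -/
noncomputable def hatTransform (y : ℝ) : ℝ :=
  ∫ t in (0 : ℝ)..1, 2 * (1 - t) * Real.cos (t * y)

theorem sq_mul_hatTransform (y : ℝ) : y ^ 2 * hatTransform y = 2 * (1 - Real.cos y) := by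
  have hd : ∀ t ∈ Set.uIcc (0 : ℝ) 1,
      HasDerivAt (fun t => y * (2 * (1 - t) * Real.sin (t * y)) - 2 * Real.cos (t * y))
        (y ^ 2 * (2 * (1 - t) * Real.cos (t * y))) t := by
    intro t _
    have h1 : HasDerivAt (fun t : ℝ => t * y) y t := by simpa using (hasDerivAt_id t).mul_const y
    have h2 : HasDerivAt (fun t : ℝ => 2 * (1 - t)) (-2) t := by
      simpa using ((hasDerivAt_id t).const_sub 1).const_mul 2
    refine (((h2.fun_mul h1.sin).const_mul y).fun_sub (h1.cos.const_mul 2)).congr_deriv ?_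
    ring
  rw [hatTransform, ← intervalIntegral.integral_const_mul,
    intervalIntegral.integral_eq_sub_of_hasDerivAt hd
      (Continuous.intervalIntegrable (by fun_prop) _ _)]
  simp
  ring

/-- The symbol of the smoothing operator with step `h`. -/
noncomputable def smoothingSymbol (k : ℕ) (h : ℝ) (l : ℤ) : ℝ :=
  ∑ i ∈ Finset.range k, 2 * (-1) ^ i * binomRatio k (i + 1) * hatTransform ((i + 1) * (l * h))

/-- The factor `l²` turns each hat transform into a multiple of `1 - cos`, so the symbol becomes a
finite combination of translations whose norm is bounded by its coefficients. -/
theorem sq_mul_smoothingSymbol (k : ℕ) {h : ℝ} (hh : h ≠ 0) (l : ℤ) :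
    l ^ 2 * smoothingSymbol k h l = 4 / h ^ 2 *
      (∑ i ∈ Finset.range k, (-1) ^ i * (binomRatio k (i + 1) / (i + 1) ^ 2) +
        ∑ i ∈ Finset.range k, -((-1) ^ i * (binomRatio k (i + 1) / (i + 1) ^ 2)) *
          Real.cos (l * ((i + 1) * h))) := by
  rw [smoothingSymbol, Finset.mul_sum, ← Finset.sum_add_distrib, Finset.mul_sum]
  refine Finset.sum_congr rfl fun i _ => ?_
  have h1 := sq_mul_hatTransform ((i + 1) * (l * h))
  rw [show (l : ℝ) * ((i + 1) * h) = (i + 1) * (l * h) by ring]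
  have hi : (i + 1 : ℝ) ≠ 0 := by positivity
  generalize hatTransform ((i + 1) * (l * h)) = H at h1 ⊢
  generalize Real.cos ((i + 1) * (l * h)) = G at h1 ⊢
  field_simp
  linear_combination (2 * binomRatio k (i + 1)) * h1

/-- The step `π / n` is critical: `4 / (π/n)² * 2 * (π²/8) = n²` exactly. Only the deficit `1 / (2
(√k + 1))` from `abs_sum_add_sum_binomRatio_le` brings the factor below one. -/
theorem hasMultiplierBound_sq_mul_smoothingSymbol {k : ℕ} (hk : 1 ≤ k) {n : ℕ} (hn : 1 ≤ n) :
    HasMultiplierBound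
      (fun l => ((l ^ 2 * smoothingSymbol k (Real.pi / n) l : ℝ) : ℂ))
      ((1 - 4 / (Real.pi ^ 2 * (Real.sqrt k + 1))) * n ^ 2) := by
  have hpi := Real.pi_pos
  have hn0 : (0 : ℝ) < n := by exact_mod_cast hn
  have hh : Real.pi / n ≠ 0 := by positivity
  set b : ℕ → ℝ := fun i => binomRatio k (i + 1) / (i + 1) ^ 2 with hb
  have hb0 : ∀ i, 0 ≤ b i := fun i => div_nonneg (binomRatio_nonneg _ _) (by positivity)
  have h := ((HasMultiplierBound.one.const_mul
      ((∑ i ∈ Finset.range k, (-1) ^ i * b i : ℝ) : ℂ)).add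
    (HasMultiplierBound.sum (Finset.range k) fun i _ =>
      (HasMultiplierBound.cos ((i + 1) * (Real.pi / n))).const_mul
        ((-((-1) ^ i * b i) : ℝ) : ℂ))).const_mul ((4 / (Real.pi / n) ^ 2 : ℝ) : ℂ)
  simp only [Complex.norm_real, mul_one] at h
  have hB := abs_sum_add_sum_binomRatio_le k hk
  have e1 : (fun l : ℤ => ((l ^ 2 * smoothingSymbol k (Real.pi / n) l : ℝ) : ℂ)) =
      fun l : ℤ => ((4 / (Real.pi / n) ^ 2 : ℝ) : ℂ) *
        (((∑ i ∈ Finset.range k, (-1) ^ i * b i : ℝ) : ℂ) + ∑ i ∈ Finset.range k,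
          ((-((-1) ^ i * b i) : ℝ) : ℂ) * (Real.cos (l * ((i + 1) * (Real.pi / n))) : ℝ)) := by
    ext l
    rw [sq_mul_smoothingSymbol k hh]
    simp only [hb]
    push_cast
    rfl
  rw [e1]
  refine h.mono ?_
  have e2 : ∀ i, ‖-((-1) ^ i * b i)‖ = b i := by
    intro i
    rw [norm_neg, norm_mul, norm_pow, norm_neg, norm_one, one_pow, one_mul,
      Real.norm_of_nonneg (hb0 i)]
  simp only [e2]
  rw [Real.norm_of_nonneg (by positivity), Real.norm_eq_abs]
  refine (mul_le_mul_of_nonneg_left hB (by positivity)).trans (le_of_eq ?_)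
  have : Real.sqrt k + 1 ≠ 0 := by positivity
  field_simp
  ring

theorem sum_range_two_mul_add_one {M : Type*} [AddCommMonoid M] (g : ℕ → M) (k : ℕ) :
    ∑ j ∈ Finset.range (2 * k + 1), g j =
      g k + ∑ i ∈ Finset.range k, (g (k + (i + 1)) + g (k - (i + 1))) := by
  rw [show 2 * k + 1 = k + (k + 1) by ring, Finset.sum_range_add, Finset.sum_range_succ',
    Finset.sum_add_distrib, ← Finset.sum_range_reflect]
  have : ∀ i, k - 1 - i = k - (i + 1) := fun i => by omega
  simp only [this, add_zero]
  abel

theorem sum_choose_mul_exp (k : ℕ) (y : ℝ) :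
    ∑ j ∈ Finset.range (2 * k + 1), (-1 : ℂ) ^ j * ((2 * k).choose j : ℂ) *
        Complex.exp (Complex.I * (j - k) * y) =
      (-1) ^ k * ((2 * k).choose k : ℂ) * ((1 - ∑ i ∈ Finset.range k,
        2 * (-1) ^ i * binomRatio k (i + 1) * Real.cos ((i + 1) * y) : ℝ) : ℂ) := by
  have hC : ((2 * k).choose k : ℂ) ≠ 0 := by
    exact_mod_cast (Nat.choose_pos (by omega)).ne'
  rw [sum_range_two_mul_add_one, Complex.ofReal_sub, Complex.ofReal_one, Complex.ofReal_sum,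
    mul_sub (_ * _) 1, mul_one, sub_eq_add_neg _ (_ * _), Finset.mul_sum, ← Finset.sum_neg_distrib]
  congr 1
  · simp
  refine Finset.sum_congr rfl fun i hi => ?_
  have hi' : i + 1 ≤ k := by rw [Finset.mem_range] at hi; omega
  have h1 : (2 * k).choose (k - (i + 1)) = (2 * k).choose (k + (i + 1)) :=
    Nat.choose_symm_of_eq_add (by omega)
  have h2 : (-1 : ℂ) ^ (k - (i + 1)) = (-1) ^ (k + (i + 1)) := by
    rw [show k + (i + 1) = k - (i + 1) + 2 * (i + 1) by omega, pow_add, pow_mul (-1 : ℂ) 2]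
    simp
  rw [h1, h2, Nat.cast_sub hi', binomRatio]
  push_cast
  rw [Complex.cos, show Complex.I * (k + (i + 1) - k) * y = (i + 1) * y * Complex.I by ring,
    show Complex.I * (k - (i + 1) - k) * y = -((i + 1) * y) * Complex.I by ring]
  field_simp
  ring

theorem trigSum_central_difference (k : ℕ) (s : Finset ℤ) (c : ℤ → ℂ) (h x : ℝ) :
    ((2 * k).choose k : ℂ) * trigSum s (fun l => ((1 - ∑ i ∈ Finset.range k,
        2 * (-1) ^ i * binomRatio k (i + 1) * Real.cos ((i + 1) * (l * h)) : ℝ) : ℂ) * c l) x =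
      (-1) ^ k * ∑ j ∈ Finset.range (2 * k + 1), (-1 : ℂ) ^ j * ((2 * k).choose j : ℂ) *
        trigSum s c (x - k * h + j * h) := by
  have e : ∀ j : ℕ, trigSum s c (x - k * h + j * h) =
      trigSum s (fun l => Complex.exp (Complex.I * (j - k) * (l * h : ℝ)) * c l) x := by
    intro j
    rw [show x - k * h + j * h = x + (j - k) * h by ring, ← trigSum_exp_mul]
    congr 1
    ext l
    push_cast
    ring_nf
  simp only [e, ← trigSum_const_mul, ← trigSum_sum]
  congr 1
  ext l
  simp only [← mul_assoc]
  rw [← Finset.sum_mul, ← mul_assoc, sum_choose_mul_exp]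
  simp only [← mul_assoc]
  rw [← mul_pow]
  norm_num

/-- The error of the smoothing operator is controlled by the differences of order `2k`. -/
theorem norm_trigSum_one_sub_smoothingSymbol_le (k : ℕ) (s : Finset ℤ) (c : ℤ → ℂ) {h W : ℝ}
    (hh : 0 < h)
    (hW : ∀ t ∈ Set.Ioc 0 h, ∀ x : ℝ, ‖∑ j ∈ Finset.range (2 * k + 1),
      (-1 : ℂ) ^ j * ((2 * k).choose j : ℂ) * trigSum s c (x + j * t)‖ ≤ W) (x : ℝ) :
    ‖trigSum s (fun l => (1 - (smoothingSymbol k h l : ℂ)) * c l) x‖ ≤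
      W / (2 * k).choose k := by
  have hC : (0 : ℝ) < ((2 * k).choose k : ℝ) := by
    exact_mod_cast Nat.choose_pos (by omega)
  -- Symbol of the normalised central difference of step `t * h`; the weight `2 * (1 - t)` has mass
  -- one and averages it to `1 - smoothingSymbol k h`.
  set q : ℝ → ℤ → ℝ := fun t l => 1 - ∑ i ∈ Finset.range k,
    2 * (-1) ^ i * binomRatio k (i + 1) * Real.cos ((i + 1) * (l * (t * h))) with hq
  have hqc : ∀ l, Continuous fun t => q t l := by
    intro l
    simp only [hq]
    fun_prop
  have hone : ∫ t in (0 : ℝ)..1, 2 * (1 - t) = 1 := by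
    rw [intervalIntegral.integral_const_mul, intervalIntegral.integral_sub (by simp) (by simp)]
    simp
    norm_num
  have hint : ∀ l, ∫ t in (0 : ℝ)..1, 2 * (1 - t) * q t l = 1 - smoothingSymbol k h l := by
    intro l
    have : ∀ t, 2 * (1 - t) * q t l = 2 * (1 - t) - ∑ i ∈ Finset.range k,
        2 * (-1) ^ i * binomRatio k (i + 1) *
          (2 * (1 - t) * Real.cos (t * ((i + 1) * (l * h)))) := by
      intro t
      simp only [hq]
      rw [mul_sub, mul_one, Finset.mul_sum]
      congr 1
      refine Finset.sum_congr rfl fun i _ => ?_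
      rw [show (i + 1 : ℝ) * (l * (t * h)) = t * ((i + 1) * (l * h)) by ring]
      ring
    simp only [this]
    rw [intervalIntegral.integral_sub (Continuous.intervalIntegrable (by fun_prop) _ _)
      (Continuous.intervalIntegrable (by fun_prop) _ _), hone,
      intervalIntegral.integral_finsetSum
        (fun i _ => Continuous.intervalIntegrable (by fun_prop) _ _)]
    simp only [intervalIntegral.integral_const_mul]
    rfl
  have hrep : trigSum s (fun l => (1 - (smoothingSymbol k h l : ℂ)) * c l) x =
      ∫ t in (0 : ℝ)..1, ((2 * (1 - t) : ℝ) : ℂ) *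
        trigSum s (fun l => (q t l : ℂ) * c l) x := by
    have : ∀ t : ℝ, ((2 * (1 - t) : ℝ) : ℂ) * trigSum s (fun l => (q t l : ℂ) * c l) x =
        ∑ l ∈ s, (((2 * (1 - t) * q t l : ℝ) : ℂ)) *
          (c l * Complex.exp (Complex.I * l * x)) := by
      intro t
      rw [trigSum, Finset.mul_sum]
      refine Finset.sum_congr rfl fun l _ => ?_
      push_cast
      ring
    simp only [this]
    rw [intervalIntegral.integral_finsetSum
      (fun l _ => Continuous.intervalIntegrable (by have := hqc l; fun_prop) _ _)]
    refine Finset.sum_congr rfl fun l _ => ?_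
    rw [intervalIntegral.integral_mul_const, intervalIntegral.integral_ofReal, hint]
    push_cast
    ring
  rw [hrep]
  have hbound : ‖∫ t in (0 : ℝ)..1, ((2 * (1 - t) : ℝ) : ℂ) *
      trigSum s (fun l => (q t l : ℂ) * c l) x‖ ≤
      ∫ t in (0 : ℝ)..1, 2 * (1 - t) * (W / (2 * k).choose k) := by
    refine intervalIntegral.norm_integral_le_of_norm_le zero_le_one
      (Filter.Eventually.of_forall fun t ht => ?_)
      (Continuous.intervalIntegrable (by fun_prop) _ _)
    have h0 : (0 : ℝ) ≤ 2 * (1 - t) := by linarith [ht.2]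
    rw [norm_mul, Complex.norm_real, Real.norm_of_nonneg h0]
    refine mul_le_mul_of_nonneg_left ?_ h0
    rw [le_div_iff₀' hC]
    -- Recentring by `k` steps is free because `hW` is uniform in `x`.
    have h1 := hW (t * h) ⟨mul_pos ht.1 hh, mul_le_of_le_one_left hh.le ht.2⟩ (x - k * (t * h))
    have h2 := congrArg norm (trigSum_central_difference k s c (t * h) x)
    rw [norm_mul, norm_mul, norm_pow, norm_neg, norm_one, one_pow, one_mul,
      Complex.norm_natCast] at h2
    exact h2.trans_le h1
  rwa [intervalIntegral.integral_mul_const, hone, one_mul] at hbound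

/-- The Jackson–Stechkin estimate of even order for exponential sums. -/
theorem exists_trigSum_approx {k : ℕ} (hk : 1 ≤ k) {n : ℕ} (hn : 1 ≤ n) (s : Finset ℤ)
    (c : ℤ → ℂ) {W : ℝ}
    (hW : ∀ t ∈ Set.Ioc 0 (Real.pi / n), ∀ x : ℝ, ‖∑ j ∈ Finset.range (2 * k + 1),
      (-1 : ℂ) ^ j * ((2 * k).choose j : ℂ) * trigSum s c (x + j * t)‖ ≤ W)
    {ε : ℝ} (hε : 0 < ε) :
    ∃ d : ℤ → ℂ, (∀ l, n ≤ l.natAbs → d l = 0) ∧ ∀ x, ‖trigSum s c x - trigSum s d x‖ ≤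
      Real.pi ^ 2 / 2 * (Real.sqrt k + 1) * (W / (2 * k).choose k) + ε := by
  have hn0 : (0 : ℝ) < n := by exact_mod_cast hn
  have hpi := Real.pi_gt_three
  have hs : (1 : ℝ) ≤ Real.sqrt k := Real.one_le_sqrt.2 (by exact_mod_cast hk)
  have hlt : 4 / (Real.pi ^ 2 * (Real.sqrt k + 1)) ≤ 1 := by
    rw [div_le_one (by positivity)]
    nlinarith
  have hpos : 0 < 4 / (Real.pi ^ 2 * (Real.sqrt k + 1)) := by positivity
  obtain ⟨d, hd, hd'⟩ := exists_approx_of_multiplier hn (sub_nonneg.2 hlt)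
    (sub_lt_self _ hpos) (hasMultiplierBound_sq_mul_smoothingSymbol hk hn)
    (u := fun l => (smoothingSymbol k (Real.pi / n) l : ℂ)) (fun l => by push_cast; rfl) s c
    (norm_trigSum_one_sub_smoothingSymbol_le k s c (by positivity) hW) hε
  refine ⟨d, hd, fun x => (hd' x).trans (le_of_eq ?_)⟩
  congr 1
  rw [sub_sub_cancel]
  field_simp
  ring

end JacksonStechkin

/-! ### Real functions and the final estimate -/

namespace JacksonStechkin

theorem exists_norm_sub_trigSum_le {f : ℝ → ℝ} (hf : Continuous f)
    (hper : Function.Periodic f (2 * Real.pi)) {δ : ℝ} (hδ : 0 < δ) :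
    ∃ (s : Finset ℤ) (c : ℤ → ℂ), ∀ x, ‖(f x : ℂ) - trigSum s c x‖ ≤ δ := by
  have : Fact (0 < 2 * Real.pi) := ⟨by positivity⟩
  have hper' : Function.Periodic (fun x => (f x : ℂ)) (2 * Real.pi) := fun x => by
    simp only [hper x]
  set F : C(AddCircle (2 * Real.pi), ℂ) := ⟨hper'.lift, continuous_coinduced_dom.2
    (show Continuous fun x => (f x : ℂ) by fun_prop)⟩ with hF
  have hmem : F ∈ (Submodule.span ℂ
      (Set.range (@fourier (2 * Real.pi)))).topologicalClosure := by
    rw [span_fourier_closure_eq_top]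
    trivial
  obtain ⟨p, hp, hFp⟩ := Metric.mem_closure_iff.1 hmem δ hδ
  obtain ⟨c, rfl⟩ := Finsupp.mem_span_range_iff_exists_finsupp.1 hp
  have e : ∀ x : ℝ, (c.sum fun l a => a • fourier l : C(AddCircle (2 * Real.pi), ℂ)) x =
      trigSum c.support c x := by
    intro x
    rw [Finsupp.sum, ContinuousMap.coe_sum, Finset.sum_apply]
    refine Finset.sum_congr rfl fun l _ => ?_
    rw [ContinuousMap.coe_smul, Pi.smul_apply, fourier_coe_apply, smul_eq_mul]
    congr 2
    have : (Real.pi : ℂ) ≠ 0 := by exact_mod_cast Real.pi_ne_zero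
    push_cast
    field_simp
  refine ⟨c.support, c, fun x => ?_⟩
  have h1 := (ContinuousMap.dist_apply_le_dist (x : AddCircle (2 * Real.pi))).trans hFp.le
  rwa [e, dist_eq_norm] at h1

theorem zero_mem_trigPolys (N : ℕ) : (fun _ => 0) ∈ trigPolys N :=
  ⟨0, 0, fun x => by simp⟩

theorem add_mem_trigPolys {N : ℕ} {σ τ : ℝ → ℝ} (hσ : σ ∈ trigPolys N) (hτ : τ ∈ trigPolys N) :
    (fun x => σ x + τ x) ∈ trigPolys N := by
  obtain ⟨a, b, h⟩ := hσ
  obtain ⟨a', b', h'⟩ := hτ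
  refine ⟨a + a', b + b', fun x => ?_⟩
  simp only [h, h', ← Finset.sum_add_distrib, Pi.add_apply]
  exact Finset.sum_congr rfl fun k _ => by ring

theorem re_mul_exp_mem_trigPolys {N : ℕ} {l : ℤ} (hl : l.natAbs ≤ N) (z : ℂ) :
    (fun x : ℝ => (z * Complex.exp (Complex.I * l * x)).re) ∈ trigPolys N := by
  refine ⟨Pi.single l.natAbs z.re, Pi.single l.natAbs (-z.im * l.sign), fun x => ?_⟩
  rw [Finset.sum_eq_single_of_mem l.natAbs (by simp; omega)
    (fun k _ hk => by simp [Pi.single_eq_of_ne hk])]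
  have h1 : Complex.I * l * x = ((l * x : ℝ) : ℂ) * Complex.I := by push_cast; ring
  beta_reduce
  rw [h1, Complex.mul_re, Complex.exp_ofReal_mul_I_re, Complex.exp_ofReal_mul_I_im,
    Pi.single_eq_same, Pi.single_eq_same]
  rcases lt_trichotomy l 0 with h | h | h
  · have e : (l : ℝ) = -(l.natAbs : ℝ) := by
      rw [Nat.cast_natAbs, abs_of_neg h]
      simp
    rw [e, neg_mul, Real.cos_neg, Real.sin_neg, Int.sign_eq_neg_one_of_neg h]
    push_cast
    ring
  · subst h
    simp
  · have e : (l : ℝ) = (l.natAbs : ℝ) := by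
      rw [Nat.cast_natAbs, abs_of_pos h]
    rw [e, Int.sign_eq_one_of_pos h]
    push_cast
    ring

theorem re_trigSum_mem_trigPolys {N : ℕ} (s : Finset ℤ) {d : ℤ → ℂ}
    (hd : ∀ l : ℤ, N < l.natAbs → d l = 0) : (fun x => (trigSum s d x).re) ∈ trigPolys N := by
  induction s using Finset.induction_on with
  | empty => simpa [trigSum] using zero_mem_trigPolys N
  | insert l s hl ih =>
    simp only [trigSum, Finset.sum_insert hl, Complex.add_re]
    refine add_mem_trigPolys ?_ ih
    rcases Nat.lt_or_ge N l.natAbs with h | h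
    · simpa [hd l h] using zero_mem_trigPolys N
    · exact re_mul_exp_mem_trigPolys h _

theorem supNorm_nonneg (f : ℝ → ℝ) : 0 ≤ supNorm f := Real.iSup_nonneg fun _ => abs_nonneg _

theorem bestApprox_le {N : ℕ} {f τ : ℝ → ℝ} (hτ : τ ∈ trigPolys N) {B : ℝ}
    (hB : ∀ x, |f x - τ x| ≤ B) : bestApprox N f ≤ B :=
  (ciInf_le ⟨0, by rintro _ ⟨σ, rfl⟩; exact supNorm_nonneg _⟩ (⟨τ, hτ⟩ : trigPolys N)).trans
    (ciSup_le hB)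

theorem sum_choose_two_pow (r : ℕ) :
    ∑ i ∈ Finset.range (r + 1), (r.choose i : ℝ) = 2 ^ r := by
  exact_mod_cast Nat.sum_range_choose r

theorem abs_difference_le {f : ℝ → ℝ} {M : ℝ} (hM : ∀ x, |f x| ≤ M) (r : ℕ) (h x : ℝ) :
    |difference r h f x| ≤ 2 ^ r * M := by
  rw [difference, ← sum_choose_two_pow, Finset.sum_mul]
  refine (Finset.abs_sum_le_sum_abs _ _).trans (Finset.sum_le_sum fun i _ => ?_)
  rw [abs_mul, abs_mul, abs_pow, abs_neg, abs_one, one_pow, one_mul, Nat.abs_cast]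
  exact mul_le_mul_of_nonneg_left (hM _) (Nat.cast_nonneg _)

/-- A bound on `f` is needed because a real supremum over an unbounded family defaults to zero. -/
theorem abs_difference_le_modulus {f : ℝ → ℝ} {M : ℝ} (hM : ∀ x, |f x| ≤ M) (r : ℕ) {δ h : ℝ}
    (hh : h ∈ Set.Ioc 0 δ) (x : ℝ) : |difference r h f x| ≤ modulus r f δ := by
  have h1 : |difference r h f x| ≤ supNorm (difference r h f) :=
    le_ciSup (f := fun x => |difference r h f x|)
      ⟨2 ^ r * M, by rintro _ ⟨y, rfl⟩; exact abs_difference_le hM r h y⟩ x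
  refine h1.trans (le_ciSup (f := fun h : Set.Ioc (0 : ℝ) δ => supNorm (difference r (h : ℝ) f))
    ⟨2 ^ r * M, ?_⟩ ⟨h, hh⟩)
  rintro _ ⟨t, rfl⟩
  exact ciSup_le fun y => abs_difference_le hM r t y

theorem difference_succ (r : ℕ) (h : ℝ) (f : ℝ → ℝ) (x : ℝ) :
    difference (r + 1) h f x = difference r h f x - difference r h f (x + h) := by
  have := Finset.sum_choose_succ_mul (fun i _ => (-1 : ℝ) ^ i * f (x + i * h)) r
  simp only [difference]
  rw [← Finset.sum_sub_distrib]
  rw [← Finset.sum_add_distrib] at this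
  convert this using 1
  · exact Finset.sum_congr rfl fun i _ => by ring
  · refine Finset.sum_congr rfl fun i _ => ?_
    rw [show x + h + i * h = x + ((i + 1 : ℕ) : ℝ) * h by push_cast; ring]
    ring

/-- The Jackson–Stechkin estimate of even order. -/
theorem bestApprox_le_of_difference_le {k : ℕ} (hk : 1 ≤ k) {n : ℕ} (hn : 1 ≤ n) {f : ℝ → ℝ}
    (hf : Continuous f) (hper : Function.Periodic f (2 * Real.pi)) {W : ℝ}
    (hW : ∀ t ∈ Set.Ioc 0 (Real.pi / n), ∀ x, |difference (2 * k) t f x| ≤ W) :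
    bestApprox (n - 1) f ≤
      Real.pi ^ 2 / 2 * (Real.sqrt k + 1) * (W / (2 * k).choose k) := by
  refine le_of_forall_pos_le_add fun ε hε => ?_
  set K : ℝ := Real.pi ^ 2 / 2 * (Real.sqrt k + 1) with hK
  have hK0 : 0 ≤ K := by positivity
  set B : ℝ := ((2 * k).choose k : ℝ) with hB
  have hB0 : 0 < B := by
    rw [hB]
    exact_mod_cast Nat.choose_pos (by omega)
  -- Error budget in units of `ε / A`: one for replacing `f` by an exponential sum, one for the
  -- slack in `exists_trigSum_approx`, and `K * 2 ^ (2k) / B` for the enlarged `W`.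
  set A : ℝ := 2 + K * (2 ^ (2 * k) / B) with hA
  have hA0 : 0 < A := by positivity
  obtain ⟨s, c, hsc⟩ := exists_norm_sub_trigSum_le hf hper (div_pos hε hA0)
  have hW' : ∀ t ∈ Set.Ioc 0 (Real.pi / n), ∀ x : ℝ, ‖∑ j ∈ Finset.range (2 * k + 1),
      (-1 : ℂ) ^ j * ((2 * k).choose j : ℂ) * trigSum s c (x + j * t)‖ ≤
      W + 2 ^ (2 * k) * (ε / A) := by
    intro t ht x
    have e : ∑ j ∈ Finset.range (2 * k + 1),
        (-1 : ℂ) ^ j * ((2 * k).choose j : ℂ) * trigSum s c (x + j * t) =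
        ((difference (2 * k) t f x : ℝ) : ℂ) - ∑ j ∈ Finset.range (2 * k + 1),
        (-1 : ℂ) ^ j * ((2 * k).choose j : ℂ) *
          ((f (x + j * t) : ℂ) - trigSum s c (x + j * t)) := by
      rw [difference]
      push_cast
      rw [← Finset.sum_sub_distrib]
      exact Finset.sum_congr rfl fun j _ => by ring
    rw [e]
    refine (norm_sub_le _ _).trans (add_le_add ?_ ?_)
    · rw [Complex.norm_real]
      exact hW t ht x
    · rw [← sum_choose_two_pow, Finset.sum_mul]
      refine (norm_sum_le _ _).trans (Finset.sum_le_sum fun j _ => ?_)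
      rw [norm_mul, norm_mul, norm_pow, norm_neg, norm_one, one_pow, one_mul,
        Complex.norm_natCast]
      exact mul_le_mul_of_nonneg_left (hsc _) (Nat.cast_nonneg _)
  obtain ⟨d, hd, hsd⟩ := exists_trigSum_approx hk hn s c hW' (div_pos hε hA0)
  refine bestApprox_le (re_trigSum_mem_trigPolys s (d := d) fun l hl => hd l (by omega))
    fun x => ?_
  have h1 : |f x - (trigSum s d x).re| ≤ ‖(f x : ℂ) - trigSum s d x‖ := by
    have := Complex.abs_re_le_norm ((f x : ℂ) - trigSum s d x)
    rwa [Complex.sub_re, Complex.ofReal_re] at this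
  have h2 : ‖(f x : ℂ) - trigSum s d x‖ ≤
      ‖(f x : ℂ) - trigSum s c x‖ + ‖trigSum s c x - trigSum s d x‖ :=
    norm_sub_le_norm_sub_add_norm_sub _ _ _
  refine h1.trans (h2.trans ((add_le_add (hsc x) (hsd x)).trans (le_of_eq ?_)))
  have h3 : ε = A * (ε / A) := by field_simp
  rw [add_div, mul_add]
  nth_rewrite 4 [h3]
  rw [hA]
  ring

theorem bestApprox_le_of_difference_le_mul_sqrt {r k : ℕ} (hk : 1 ≤ k) (hkr : k ≤ r) {n : ℕ}
    (hn : 1 ≤ n) {f : ℝ → ℝ} (hf : Continuous f) (hper : Function.Periodic f (2 * Real.pi))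
    {W : ℝ} (hW : ∀ t ∈ Set.Ioc 0 (Real.pi / n), ∀ x, |difference (2 * k) t f x| ≤ W) :
    bestApprox (n - 1) f ≤ 10 * Real.sqrt r * (W / (2 * k).choose k) := by
  have hn0 : (0 : ℝ) < n := by exact_mod_cast hn
  have hW0 : 0 ≤ W := (abs_nonneg _).trans
    (hW (Real.pi / n) ⟨by positivity, le_rfl⟩ 0)
  refine (bestApprox_le_of_difference_le hk hn hf hper hW).trans
    (mul_le_mul_of_nonneg_right ?_ (by positivity))
  have h1 : (1 : ℝ) ≤ Real.sqrt k := Real.one_le_sqrt.2 (by exact_mod_cast hk)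
  have h2 : Real.sqrt k ≤ Real.sqrt r := Real.sqrt_le_sqrt (by exact_mod_cast hkr)
  have h3 : Real.pi ^ 2 ≤ 10 := by nlinarith [Real.pi_lt_d2, Real.pi_pos]
  nlinarith

theorem bestApprox_le_mul_gammaStar_mul_modulus {r : ℕ} (hr : 1 ≤ r) {n : ℕ} (hn : 1 ≤ n)
    {f : ℝ → ℝ} (hf : Continuous f) (hper : Function.Periodic f (2 * Real.pi)) :
    bestApprox (n - 1) f ≤
      10 * Real.sqrt r * gammaStar r * modulus r f (Real.pi / n) := by
  obtain ⟨M, hM⟩ : ∃ M, ∀ x, |f x| ≤ M := by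
    obtain ⟨M, hM⟩ := (hper.isBounded_of_continuous (by positivity) hf).exists_norm_le
    exact ⟨M, fun x => hM _ ⟨x, rfl⟩⟩
  rcases Nat.even_or_odd' r with ⟨k, rfl | rfl⟩
  · refine (bestApprox_le_of_difference_le_mul_sqrt (by omega) (show k ≤ 2 * k by omega) hn hf hper
      fun t ht x => abs_difference_le_modulus hM (2 * k) ht x).trans (le_of_eq ?_)
    rw [gammaStar, Nat.mul_div_cancel_left k two_pos]
    ring
  -- Passing from order `2k + 1` to `2k + 2` at most doubles the bound on differences and exactly
  -- doubles the middle binomial coefficient, so the two factors cancel.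
  · refine (bestApprox_le_of_difference_le_mul_sqrt (k := k + 1)
      (W := 2 * modulus (2 * k + 1) f (Real.pi / n)) (by omega)
      (show k + 1 ≤ 2 * k + 1 by omega) hn hf hper
      fun t ht x => ?_).trans (le_of_eq ?_)
    · rw [show 2 * (k + 1) = 2 * k + 1 + 1 by ring, difference_succ, two_mul (modulus _ _ _)]
      exact (abs_sub _ _).trans (add_le_add (abs_difference_le_modulus hM _ ht x)
        (abs_difference_le_modulus hM _ ht _))
    · have h1 : (2 * (k + 1)).choose (k + 1) = 2 * (2 * k + 1).choose k := by
        rw [show 2 * (k + 1) = 2 * k + 1 + 1 by ring, Nat.choose_succ_succ,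
          Nat.choose_symm_half, two_mul ((2 * k + 1).choose k)]
      rw [gammaStar, show (2 * k + 1) / 2 = k by omega, h1]
      have h2 : ((2 * k + 1).choose k : ℝ) ≠ 0 := by
        exact_mod_cast (Nat.choose_pos (by omega)).ne'
      push_cast
      field_simp

end JacksonStechkin

theorem theorem3 :
    ∃ c : ℕ → ℝ,
      (∀ r : ℕ, 1 ≤ r → ∀ n : ℕ, 1 ≤ n → ∀ f : ℝ → ℝ,
        Continuous f → Function.Periodic f (2 * Real.pi) →
          JacksonStechkin.bestApprox (n - 1) f ≤
            c r * JacksonStechkin.gammaStar r * JacksonStechkin.modulus r f (Real.pi / n)) ∧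
      Asymptotics.IsBigO Filter.atTop c (fun r : ℕ => Real.sqrt r * Real.log r) ∧
      (∀ r : ℕ, 1 ≤ r → c r < 2 * Real.sqrt r * Real.log r + 12 * Real.sqrt r) := by
  -- The value 10 comes from `π² ≤ 10` and `√k + 1 ≤ 2 √r`; the logarithmic bounds then follow with
  -- room to spare.
  refine ⟨fun r => 10 * Real.sqrt r, fun r hr n hn f hf hper =>
    JacksonStechkin.bestApprox_le_mul_gammaStar_mul_modulus hr hn hf hper, ?_, fun r hr => ?_⟩
  · refine Asymptotics.IsBigO.of_bound 10 ?_
    have h1 : ∀ᶠ r : ℕ in Filter.atTop, 1 ≤ Real.log r :=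
      (Real.tendsto_log_atTop.comp tendsto_natCast_atTop_atTop).eventually_ge_atTop 1
    filter_upwards [h1] with r hr
    have hs := Real.sqrt_nonneg r
    rw [Real.norm_of_nonneg (by positivity), Real.norm_of_nonneg (by positivity)]
    nlinarith
  · have hr' : (1 : ℝ) ≤ r := by exact_mod_cast hr
    have hs : 0 < Real.sqrt r := Real.sqrt_pos.2 (by linarith)
    have hl := Real.log_nonneg hr'
    have : 0 ≤ 2 * Real.sqrt r * Real.log r := by positivity
    linarith
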